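/- **Setting.** Let $G=(V,E)$ be a finite directed graph, let $A=\bigsqcup_{v\in V}A_v$ with each $A_v$ finite, and let $Q=\prod_{v\in V}Q_v$ with each $Q_v$ finite. An abelian network $\mathcal N$ on $G$ has at each vertex $v$ an abelian processor: commuting transition maps $t_a:Q_v\to Q_v$ $(a\in A_v)$ and message functions $o_a^u:Q_v\to A_u^*$ $(a\in A_v,\ (v,u)\in E)$ such that, from any state, input words that are equal up to permutation produce on each edge $(v,u)$ output words that are equal up to permutation. Let $M_v$ be the monoid of self-maps of $Q_v$ generated by the $t_a$, $a\in A_v$. The network is *irreducible* if for every $v$ and all $q,q'\in Q_v$ there are $m,m'\in M_v$ with $mq=m'q'$. **Executions.** A total state $\mathbf x.\mathbf q$ consists of $\mathbf x\in\mathbb Z^A$ (letters waiting) and $\mathbf q\in Q$. Processing a letter $a\in A_v$ decreases $\mathbf x_a$ by one, adds the letters of the words $o_a^u(\mathbf q_v)$ to $\mathbf x$, and replaces $\mathbf q_v$ by $t_a(\mathbf q_v)$. A word $w\in A^*$ is *legal* for $\mathbf x.\mathbf q$ if each of its letters is present (count at least $1$) when it is processed, and *complete* if after executing $w$ all letter counts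 are $\le 0$. The network *halts on all inputs* if every $\mathbf x.\mathbf q$ with $\mathbf x\in\mathbb N^A$, $\mathbf q\in Q$ has a complete legal execution; the *odometer* $[\mathbf x.\mathbf q]\in\mathbb N^A$ then counts the occurrences of each letter in any complete legal execution. **Production matrix.** Let $e_v$ be the minimal idempotent of $M_v$ (the unique idempotent $e$ with $e\in M_vm$ for all $m\in M_v$). A state $\mathbf q$ is *locally recurrent* if $\mathbf q_v\in e_vQ_v$ for all $v$. The maps $t_a$ permute $e_vQ_v$, so $\mathbb Z^{A_v}$ acts on $e_vQ_v$; let $K_v$ be the kernel of this action and $K=\prod_vK_v\subset\mathbb Z^A$. For $\mathbf k\in K\cap\mathbb N^A$ and $\mathbf q$ locally recurrent, processing exactly the letters $\mathbf k$ (each $a$ being processed $\mathbf k_a$ times) from $\mathbf k.\mathbf q$ results in $P_{\mathbf q}(\mathbf k).\mathbf q$ with $P_{\mathbf q}(\mathbf k)\in\mathbb N^A$. The *production matrix* $P$ is the rational $A\times A$ matrix whose column at $a$ is $\frac1{r_a}P_{\mathbf q}(r_a\mathbf 1_a)$, where $r_a=\min\{m\ge1: m\mathbf 1_a\in K\}$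 and $\mathbf q$ is a locally recurrent state. **Theorem.** Let $\mathcal N$ be a finite irreducible abelian network that halts on all inputs. Then $P\mathbf k=P_{\mathbf q}(\mathbf k)$ for all $\mathbf k\in K\cap\mathbb N^A$ and all locally recurrent $\mathbf q$, the matrix $I-P$ is invertible, and there is a constant $C$ depending only on $\mathcal N$ such that for all $\mathbf x\in\mathbb N^A$ and all $\mathbf q\in Q$, $$\big\|[\mathbf x.\mathbf q]-(I-P)^{-1}\mathbf x\big\|_\infty\le C .$$ Consequently the production matrix determines the running time up to an additive constant: there is a constant $C'$ depending only on $\mathcal N$ such that for all $\mathbf x\in\mathbb N^A$, $\mathbf q\in Q$ and every complete legal execution $w$ for $\mathbf x.\mathbf q$, the length of $w$ differs from $\mathbf 1^T(I-P)^{-1}\mathbf x$ by at most $C'$. -/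

import Mathlib

open Matrix

/-- A finite word in which every letter `a` occurs exactly `x a` times. -/
noncomputable def wordOf {I : Type*} [Fintype I] (x : I → ℕ) : List I :=
  (Finset.univ : Finset I).toList.flatMap fun a => List.replicate (x a) a

/-- `e` is the minimal idempotent of the monoid `M` of self-maps of `X`: the idempotent of `M` that
is accessible from every element of `M` (it is unique when `M` is commutative, and it exists when
`M` is moreover finite). -/
def IsMinimalIdempotent {X : Type*} (M : Submonoid (Function.End X)) (e : Function.End X) : Prop :=
  e ∈ M ∧ e * e = e ∧ ∀ m ∈ M, ∃ m' ∈ M, e = m' * m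

/-- The action of a monoid `M` of self-maps of `X` is irreducible: any two points `x, x'` satisfy
`m x = m' x'` for some `m, m' ∈ M`. -/
def IsIrreducibleAction {X : Type*} (M : Submonoid (Function.End X)) : Prop :=
  ∀ x x' : X, ∃ m ∈ M, ∃ m' ∈ M, m x = m' x'

/-- The state reached from `q` by reading a word from left to right. -/
def runWord {I Q : Type*} (t : I → Q → Q) : List I → Q → Q
  | [], q => q
  | a :: w, q => runWord t w (t a q)

/-- The word emitted while reading a word from left to right, starting in state `q`. -/
def outputWord {I Q B : Type*} (t : I → Q → Q) (o : I → Q → List B) : List I → Q → List B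
  | [], _ => []
  | a :: w, q => o a q ++ outputWord t o w (t a q)

/-- An abelian processor with input alphabet `I`, state space `Q` and output alphabets
`(B u)_{u : U}`: commuting transition maps `t a`, and message passing functions `o a u`, such that
input words equal up to permutation yield, on every feed `u` and from every state, output words
equal up to permutation. -/
structure AbelianProcessor (I Q : Type*) {U : Type*} (B : U → Type*) where
  t : I → Q → Q
  o : I → (u : U) → Q → List (B u)
  t_comm : ∀ (a b : I) (q : Q), t a (t b q) = t b (t a q)
  o_perm : ∀ (w w' : List I), w.Perm w' → ∀ (u : U) (q : Q),
    (outputWord t (fun a => o a u) w q).Perm (outputWord t (fun a => o a u) w' q)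

namespace AbelianProcessor

variable {I Q U : Type*} {B : U → Type*}

/-- The transition monoid, generated by the transition maps. -/
def transitionMonoid (p : AbelianProcessor I Q B) : Submonoid (Function.End Q) :=
  Submonoid.closure (Set.range fun a : I => (p.t a : Function.End Q))

/-- A processor is irreducible if its transition monoid acts irreducibly on its state space. -/
def IsIrreducible (p : AbelianProcessor I Q B) : Prop :=
  IsIrreducibleAction p.transitionMonoid

/-- The set `e Q`, where `e` is the minimal idempotent of the transition monoid. -/
def recurrentStates (p : AbelianProcessor I Q B) : Set Q :=
  {q | ∃ e : Function.End Q, IsMinimalIdempotent p.transitionMonoid e ∧ ∃ q' : Q, q = e q'}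

/-- The action `∏ a, (t a) ^ (x a)` of a vector `x` of natural numbers on the states. -/
noncomputable def act [Fintype I] (p : AbelianProcessor I Q B) (x : I → ℕ) (q : Q) : Q :=
  runWord p.t (wordOf x) q

/-- The kernel of the action of `ℤ ^ I` on `e Q`. As each `t a` permutes `e Q`, the integer vector
`k` with positive and negative parts `k⁺`, `k⁻` acts there as `t(k⁺) ∘ t(k⁻)⁻¹`, and it acts
trivially iff `t(k⁺)` and `t(k⁻)` agree on `e Q`. -/
def kernel [Fintype I] (p : AbelianProcessor I Q B) : Set (I → ℤ) :=
  {k | ∀ q ∈ p.recurrentStates,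
    p.act (fun a => (k a).toNat) q = p.act (fun a => (-k a).toNat) q}

end AbelianProcessor

/-- An abelian network on the directed graph `G`, with alphabet `⨆ v, A v` and state space
`∏ v, Q v`: an abelian processor at each vertex `v`, whose input alphabet is `A v` and whose output
alphabets are the `A u` for the out-neighbours `u` of `v`. -/
structure AbelianNetwork {V : Type*} (G : Digraph V) (A Q : V → Type*) where
  proc : (v : V) →
    AbelianProcessor (A v) (Q v) (U := {u : V // G.Adj v u}) (fun u => A u.1)

namespace AbelianNetwork

variable {V : Type*} {G : Digraph V} {A Q : V → Type*}

/-- Irreducibility of the network: every processor is irreducible. -/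
def IsIrreducible (N : AbelianNetwork G A Q) : Prop :=
  ∀ v, (N.proc v).IsIrreducible

/-- Locally recurrent states of the network. -/
def IsLocallyRecurrent (N : AbelianNetwork G A Q) (q : ∀ v, Q v) : Prop :=
  ∀ v, q v ∈ (N.proc v).recurrentStates

section Executions

variable [DecidableEq V] [∀ v, DecidableEq (A v)]

open scoped Classical in
/-- The number of letters `c` sent out when the letter `a` is processed in state `q`. -/
noncomputable def message (N : AbelianNetwork G A Q) (a : Σ v, A v) (q : ∀ v, Q v)
    (c : Σ v, A v) : ℕ :=
  if h : G.Adj a.1 c.1 then ((N.proc a.1).o a.2 ⟨c.1, h⟩ (q a.1)).count c.2 else 0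

/-- Processing one letter `a` in the total state `x.q`: one letter `a` is removed (a debt is
recorded if there is none), messages are sent, the processor owning `a` changes state. -/
noncomputable def step (N : AbelianNetwork G A Q) (a : Σ v, A v)
    (s : ((Σ v, A v) → ℤ) × (∀ v, Q v)) : ((Σ v, A v) → ℤ) × (∀ v, Q v) :=
  (fun c => s.1 c - (if c = a then 1 else 0) + N.message a s.2 c,
    Function.update s.2 a.1 ((N.proc a.1).t a.2 (s.2 a.1)))

/-- Executing a word from left to right. -/
noncomputable def exec (N : AbelianNetwork G A Q) :
    List (Σ v, A v) → ((Σ v, A v) → ℤ) × (∀ v, Q v) → ((Σ v, A v) → ℤ) × (∀ v, Q v)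
  | [], s => s
  | a :: w, s => N.exec w (N.step a s)

/-- An execution is legal if each letter it processes is present when it is processed. -/
def IsLegal (N : AbelianNetwork G A Q) :
    List (Σ v, A v) → ((Σ v, A v) → ℤ) × (∀ v, Q v) → Prop
  | [], _ => True
  | a :: w, s => 1 ≤ s.1 a ∧ N.IsLegal w (N.step a s)

/-- An execution is complete if it leaves no letters to be processed. -/
def IsComplete (N : AbelianNetwork G A Q) (w : List (Σ v, A v))
    (s : ((Σ v, A v) → ℤ) × (∀ v, Q v)) : Prop :=
  ∀ a, (N.exec w s).1 a ≤ 0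

/-- The total state `x.q` for a vector `x` of natural numbers. -/
def input (x : (Σ v, A v) → ℕ) (q : ∀ v, Q v) : ((Σ v, A v) → ℤ) × (∀ v, Q v) :=
  (fun a => (x a : ℤ), q)

/-- `w` is a complete legal execution for `x.q`. -/
def IsCompleteLegal (N : AbelianNetwork G A Q) (w : List (Σ v, A v))
    (x : (Σ v, A v) → ℕ) (q : ∀ v, Q v) : Prop :=
  N.IsLegal w (input x q) ∧ N.IsComplete w (input x q)

/-- The network halts on all inputs: every `x.q` has a complete legal execution. -/
def HaltsOnAllInputs (N : AbelianNetwork G A Q) : Prop :=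
  ∀ (x : (Σ v, A v) → ℕ) (q : ∀ v, Q v), ∃ w, N.IsCompleteLegal w x q

open scoped Classical in
/-- The odometer `[x.q]`: the letter counts of a complete legal execution for `x.q` (the choice does
not matter, see `AbelianNetwork.odometer_eq`). -/
noncomputable def odometer (N : AbelianNetwork G A Q) (x : (Σ v, A v) → ℕ) (q : ∀ v, Q v) :
    (Σ v, A v) → ℕ :=
  if h : ∃ w, N.IsCompleteLegal w x q then fun a => h.choose.count a else 0

theorem step_comm (N : AbelianNetwork G A Q) (a b : Σ v, A v)
    (s : ((Σ v, A v) → ℤ) × (∀ v, Q v)) : N.step a (N.step b s) = N.step b (N.step a s) := by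
  obtain ⟨x, q⟩ := s
  obtain ⟨v, a⟩ := a
  obtain ⟨u, b⟩ := b
  by_cases huv : v = u
  · subst huv
    refine Prod.ext ?_ ?_
    · funext c
      simp only [step, message, Function.update_self]
      split_ifs with h <;> try omega
      all_goals
        have := ((N.proc v).o_perm [a, b] [b, a] (List.Perm.swap b a []) ⟨c.1, ‹_›⟩ (q v)).count_eq
          c.2
        simp only [outputWord, List.append_nil, List.count_append] at this
        omega
    · simp [step, (N.proc v).t_comm a b]
  · refine Prod.ext ?_ ?_
    · funext c
      simp only [step, message, Function.update_of_ne huv, Function.update_of_ne (Ne.symm huv)]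
      omega
    · simp only [step, Function.update_of_ne huv, Function.update_of_ne (Ne.symm huv)]
      exact Function.update_comm (Ne.symm huv) _ _ _

/-- The result of an execution depends on the word only up to permutation. -/
theorem exec_perm (N : AbelianNetwork G A Q) {w w' : List (Σ v, A v)} (h : w.Perm w')
    (s : ((Σ v, A v) → ℤ) × (∀ v, Q v)) : N.exec w s = N.exec w' s := by
  induction h generalizing s with
  | nil => rfl
  | cons a _ ih => exact ih _
  | swap a b l => simp only [exec, N.step_comm a b s]
  | trans _ _ ih₁ ih₂ => rw [ih₁, ih₂]

theorem le_exec_of_notMem (N : AbelianNetwork G A Q) {a : Σ v, A v} {w : List (Σ v, A v)}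
    (h : a ∉ w) (s : ((Σ v, A v) → ℤ) × (∀ v, Q v)) : s.1 a ≤ (N.exec w s).1 a := by
  induction w generalizing s with
  | nil => exact le_rfl
  | cons b w ih =>
    simp only [List.mem_cons, not_or] at h
    refine le_trans ?_ (ih h.2 (N.step b s))
    simp [step, h.1]

/-- Least action principle. -/
theorem count_le_of_isLegal_of_isComplete (N : AbelianNetwork G A Q) {w w' : List (Σ v, A v)}
    {s : ((Σ v, A v) → ℤ) × (∀ v, Q v)} (hw : N.IsLegal w s) (hw' : N.IsComplete w' s)
    (c : Σ v, A v) : w.count c ≤ w'.count c := by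
  induction w generalizing w' s with
  | nil => simp
  | cons a w ih =>
    have ha : a ∈ w' := by
      by_contra h
      have h₁ := N.le_exec_of_notMem h s
      have h₂ := hw' a
      have h₃ := hw.1
      omega
    have hp := List.perm_cons_erase ha
    have hc : N.IsComplete (w'.erase a) (N.step a s) := fun b => by
      have := hw' b
      rwa [N.exec_perm hp] at this
    rw [hp.count_eq, List.count_cons, List.count_cons]
    exact Nat.add_le_add_right (ih hw.2 hc) _

/-- The odometer may be computed from any complete legal execution. -/
theorem odometer_eq (N : AbelianNetwork G A Q) {x : (Σ v, A v) → ℕ} {q : ∀ v, Q v}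
    {w : List (Σ v, A v)} (hw : N.IsCompleteLegal w x q) (a : Σ v, A v) :
    N.odometer x q a = w.count a := by
  have h : ∃ w, N.IsCompleteLegal w x q := ⟨w, hw⟩
  simp only [odometer, dif_pos h]
  exact le_antisymm (N.count_le_of_isLegal_of_isComplete h.choose_spec.1 hw.2 a)
    (N.count_le_of_isLegal_of_isComplete hw.1 h.choose_spec.2 a)

end Executions

section Production

variable [Fintype V] [DecidableEq V] [∀ v, Fintype (A v)] [∀ v, DecidableEq (A v)]

/-- The local action `x ▷ q = π_x(x.q)`: exactly the letters of `x` are processed. -/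
noncomputable def localAct (N : AbelianNetwork G A Q) (x : (Σ v, A v) → ℕ) (q : ∀ v, Q v) :
    ((Σ v, A v) → ℤ) × (∀ v, Q v) :=
  N.exec (wordOf x) (input x q)

/-- The total kernel `K = ∏ v, K v`. -/
def totalKernel (N : AbelianNetwork G A Q) : Set ((Σ v, A v) → ℤ) :=
  {k | ∀ v, (fun b : A v => k ⟨v, b⟩) ∈ (N.proc v).kernel}

/-- The reset number `r_a`, the least `m ≥ 1` such that `m` times the unit vector at `a` lies in the
total kernel. -/
noncomputable def resetNumber (N : AbelianNetwork G A Q) (a : Σ v, A v) : ℕ :=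
  sInf {m : ℕ | 1 ≤ m ∧ (Pi.single a (m : ℤ) : (Σ v, A v) → ℤ) ∈ N.totalKernel}

open scoped Classical in
/-- The production matrix: the matrix of the linear map `P` on `ℚ ^ (⨆ v, A v)` whose value at the
unit vector of `a` is `(1 / r) P_q(r 1_a)` with `r = r_a`, where `P_q(k)` is defined for nonnegative
`k` in the total kernel and for a locally recurrent state `q` by `k ▷ q = P_q(k).q`. -/
noncomputable def productionMatrix (N : AbelianNetwork G A Q) :
    Matrix (Σ v, A v) (Σ v, A v) ℚ :=
  if h : ∃ q, N.IsLocallyRecurrent q then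
    Matrix.of fun b a =>
      ((N.localAct (Pi.single a (N.resetNumber a)) h.choose).1 b : ℚ) / (N.resetNumber a : ℚ)
  else 0

/-- `P` is the matrix of the production map: `k ▷ q = P(k).q` for every nonnegative `k` in the total
kernel and every locally recurrent state `q`. -/
def RepresentsProduction (N : AbelianNetwork G A Q) (P : Matrix (Σ v, A v) (Σ v, A v) ℚ) : Prop :=
  ∀ k : (Σ v, A v) → ℕ, (fun a => (k a : ℤ)) ∈ N.totalKernel →
    ∀ q, N.IsLocallyRecurrent q →
      (∀ b, ((N.localAct k q).1 b : ℚ) = (P *ᵥ fun a => (k a : ℚ)) b) ∧ (N.localAct k q).2 = q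

end Production

end AbelianNetwork

/-! Compare the letters actually emitted while a word is processed with the prediction of the
production matrix; the difference is `discrepancy`. By the abelian property it depends on the word
only up to permutation, and it is additive under concatenation. From a locally recurrent state it
vanishes on each block of `resetNumber a` copies of `a`, and such blocks preserve the state. So only
letter counts modulo the reset numbers matter, which leaves finitely many values; commuting past a
fixed word that makes every state recurrent extends the bound to all states
(`exists_abs_discrepancy_le`).

Everything follows from this bound. Repeating a trivially acting word multiplies its discrepancy,
which must therefore be zero: this is `representsProduction`. A complete legal execution leaves
exactly zero letters, so its count vector `u` satisfies `(1 - P) u = x + d` with `d` bounded. A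
nonzero left null vector of `1 - P` would be orthogonal to `x + d` for every `x`, which is
impossible for large `x`. Applying the inverse of `1 - P` gives the estimate. -/

theorem count_wordOf {I : Type*} [Fintype I] [DecidableEq I] (x : I → ℕ) (a : I) :
    (wordOf x).count a = x a := by
  simp only [wordOf, List.count_flatMap, Function.comp_def, List.count_replicate, beq_iff_eq]
  rw [Finset.sum_map_toList]
  simp

theorem count_replicate_eq_single {I : Type*} [DecidableEq I] (a : I) (n : ℕ) (b : I) :
    (List.replicate n a).count b = (Pi.single a n : I → ℕ) b := by
  by_cases h : b = a
  · simp [h]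
  · simp [h, List.count_replicate, Ne.symm h]

theorem runWord_append {I Q : Type*} (t : I → Q → Q) (w w' : List I) (q : Q) :
    runWord t (w ++ w') q = runWord t w' (runWord t w q) := by
  induction w generalizing q with
  | nil => rfl
  | cons a w ih => exact ih _

theorem runWord_perm {I Q : Type*} {t : I → Q → Q} (ht : ∀ a b q, t a (t b q) = t b (t a q))
    {w w' : List I} (h : w.Perm w') : runWord t w = runWord t w' := by
  funext q
  induction h generalizing q with
  | nil => rfl
  | cons a _ ih => exact ih _
  | swap a b l => simp only [runWord, ht]
  | trans _ _ ih₁ ih₂ => rw [ih₁, ih₂]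

theorem runWord_replicate {I Q : Type*} (t : I → Q → Q) (a : I) (n : ℕ) (q : Q) :
    runWord t (List.replicate n a) q = (t a)^[n] q := by
  induction n generalizing q with
  | zero => rfl
  | succ n ih => exact ih _

/-! ### Minimal idempotents and recurrent states of a single processor. -/

namespace AbelianProcessor

variable {I Q U : Type*} {B : U → Type*} (p : AbelianProcessor I Q B)

theorem mem_transitionMonoid_iff {m : Function.End Q} :
    m ∈ p.transitionMonoid ↔ ∃ w, runWord p.t w = m := by
  constructor
  · intro hm
    induction hm using Submonoid.closure_induction with
    | mem x hx =>
      obtain ⟨a, rfl⟩ := hx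
      exact ⟨[a], rfl⟩
    | one => exact ⟨[], rfl⟩
    | mul x y _ _ hx hy =>
      obtain ⟨w, rfl⟩ := hx
      obtain ⟨w', rfl⟩ := hy
      exact ⟨w' ++ w, funext fun q => runWord_append p.t w' w q⟩
  · rintro ⟨w, rfl⟩
    induction w with
    | nil => exact p.transitionMonoid.one_mem
    | cons a w ih =>
      exact p.transitionMonoid.mul_mem ih (Submonoid.subset_closure ⟨a, rfl⟩)

/-- A finite processor has a minimal idempotent. -/
theorem exists_isMinimalIdempotent [Finite Q] :
    ∃ e, IsMinimalIdempotent p.transitionMonoid e := by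
  have perm := @runWord_perm _ _ _ p.t_comm
  -- `S w` is the ideal of the transition monoid generated by the action of `w`. When it has least
  -- cardinality, multiplying `w₀` by any further word can be undone.
  let S : List I → Set (Q → Q) := fun w => Set.range fun w' => runWord p.t (w ++ w')
  let w₀ := Function.argmin fun w => (S w).ncard
  have hw₀ : ∀ w, (S w₀).ncard ≤ (S w).ncard := fun w =>
    Function.argmin_le (fun w => (S w).ncard) w
  have key : ∀ w, ∃ w', runWord p.t (w₀ ++ w ++ w') = runWord p.t w₀ := fun w => by
    have hsub : S (w₀ ++ w) ⊆ S w₀ := by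
      rintro _ ⟨w', rfl⟩
      exact ⟨w ++ w', by simp only [List.append_assoc]⟩
    have heq := Set.eq_of_subset_of_ncard_le hsub (hw₀ _) (Set.toFinite _)
    have : runWord p.t w₀ ∈ S (w₀ ++ w) := by
      rw [heq]
      exact ⟨[], by simp⟩
    exact this
  obtain ⟨s, hs⟩ := key w₀
  -- Since `w₀ w₀ s` acts as `w₀`, commutativity turns `w₀ s w₀ s` into `w₀ s`.
  refine ⟨runWord p.t (w₀ ++ s), p.mem_transitionMonoid_iff.2 ⟨_, rfl⟩, ?_, ?_⟩
  · funext q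
    change runWord p.t (w₀ ++ s) (runWord p.t (w₀ ++ s) q) = runWord p.t (w₀ ++ s) q
    rw [← runWord_append, perm (w' := w₀ ++ w₀ ++ s ++ s), runWord_append, hs, runWord_append]
    classical
    rw [List.perm_iff_count]
    intro a
    simp only [List.count_append]
    omega
  · intro m hm
    obtain ⟨w, rfl⟩ := p.mem_transitionMonoid_iff.1 hm
    obtain ⟨w', hw'⟩ := key w
    refine ⟨runWord p.t (w₀ ++ w' ++ s), p.mem_transitionMonoid_iff.2 ⟨_, rfl⟩, ?_⟩
    funext q
    change runWord p.t (w₀ ++ s) q = runWord p.t (w₀ ++ w' ++ s) (runWord p.t w q)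
    rw [← runWord_append, perm (w := w ++ _) (w' := w₀ ++ w ++ w' ++ s),
      runWord_append, runWord_append _ (w₀ ++ w ++ w'), hw']
    classical
    rw [List.perm_iff_count]
    intro a
    simp only [List.count_append]
    omega

/-- Some word sends every state to a recurrent state. -/
theorem exists_runWord_mem_recurrentStates [Finite Q] :
    ∃ w, ∀ q, runWord p.t w q ∈ p.recurrentStates := by
  obtain ⟨e, he⟩ := p.exists_isMinimalIdempotent
  obtain ⟨w, rfl⟩ := p.mem_transitionMonoid_iff.1 he.1
  exact ⟨w, fun q => ⟨_, he, q, rfl⟩⟩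

variable {p}

/-- Minimality writes `e = m' * m` for every `m` in the monoid, so `m'` undoes `m` on the image of
`e`. -/
theorem exists_runWord_runWord_eq {q : Q} (hq : q ∈ p.recurrentStates) (w : List I) :
    ∃ w', runWord p.t w' (runWord p.t w q) = q := by
  obtain ⟨e, ⟨-, hidem, hmin⟩, q', rfl⟩ := hq
  obtain ⟨m', hm', h⟩ := hmin (runWord p.t w) (p.mem_transitionMonoid_iff.2 ⟨_, rfl⟩)
  obtain ⟨w', rfl⟩ := p.mem_transitionMonoid_iff.1 hm'
  exact ⟨w', (congrFun h (e q')).symm.trans (congrFun hidem q')⟩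

/-- The recurrent states of an irreducible processor are accessible from every state. -/
theorem IsIrreducible.exists_runWord_eq (hp : p.IsIrreducible) (q : Q) {q' : Q}
    (hq' : q' ∈ p.recurrentStates) : ∃ w, runWord p.t w q = q' := by
  obtain ⟨m, hm, m', hm', h⟩ := hp q q'
  obtain ⟨w, rfl⟩ := p.mem_transitionMonoid_iff.1 hm
  obtain ⟨w', rfl⟩ := p.mem_transitionMonoid_iff.1 hm'
  obtain ⟨w'', h'⟩ := exists_runWord_runWord_eq hq' w'
  exact ⟨w ++ w'', by rw [runWord_append, h, h']⟩

variable (p) in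
theorem exists_iterate_eq [Finite Q] (a : I) :
    ∃ n, 1 ≤ n ∧ ∀ q ∈ p.recurrentStates, (p.t a)^[n] q = q := by
  obtain ⟨i, j, hij, h⟩ : ∃ i j, i < j ∧ (p.t a)^[i] = (p.t a)^[j] := by
    obtain ⟨i, j, hne, h⟩ := Finite.exists_ne_map_eq_of_infinite fun n : ℕ => (p.t a)^[n]
    rcases lt_or_gt_of_ne hne with hlt | hlt
    · exact ⟨i, j, hlt, h⟩
    · exact ⟨j, i, hlt, h.symm⟩
  refine ⟨j - i, by omega, fun q hq => ?_⟩
  -- The word `w` undoes `i` copies of `a` at `q`, which cancels the preperiod in `(p.t a)^[i] =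
  -- (p.t a)^[j]`.
  obtain ⟨w, hw⟩ := exists_runWord_runWord_eq hq (List.replicate i a)
  have hc := congrFun (runWord_perm p.t_comm
    (List.perm_append_comm (l₁ := List.replicate i a ++ w) (l₂ := List.replicate (j - i) a))) q
  rw [runWord_append, runWord_append, hw, ← List.append_assoc, List.replicate_append_replicate,
    runWord_append, runWord_replicate _ _ (j - i + i), show j - i + i = j by omega, ← h,
    ← runWord_replicate, hw, runWord_replicate] at hc
  exact hc

theorem act_eq_runWord [Fintype I] [DecidableEq I] {x : I → ℕ} {w : List I}
    (h : ∀ a, w.count a = x a) (q : Q) : p.act x q = runWord p.t w q :=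
  congrFun (runWord_perm p.t_comm (List.perm_iff_count.2 fun a => by rw [count_wordOf, h])) q

end AbelianProcessor

/-! ### Network states, emitted letters and trivially acting words. -/

namespace AbelianNetwork

variable {V : Type*} {G : Digraph V} {A Q : V → Type*} [DecidableEq V]
  (N : AbelianNetwork G A Q)

/-- The change of the network state when the letter `a` is processed. -/
def transition (a : Σ v, A v) (q : ∀ v, Q v) : ∀ v, Q v :=
  Function.update q a.1 ((N.proc a.1).t a.2 (q a.1))

theorem runWord_transition_map_mk (v : V) (w : List (A v)) (q : ∀ v, Q v) :
    runWord N.transition (w.map (Sigma.mk v)) q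
      = Function.update q v (runWord (N.proc v).t w (q v)) := by
  induction w generalizing q with
  | nil => simp [runWord]
  | cons a w ih => simp [runWord, ih, transition]

theorem runWord_transition_flatMap (w : ∀ v, List (A v)) {l : List V} (hl : l.Nodup)
    (q : ∀ v, Q v) (v : V) :
    runWord N.transition (l.flatMap fun u => (w u).map (Sigma.mk u)) q v
      = if v ∈ l then runWord (N.proc v).t (w v) (q v) else q v := by
  induction l generalizing q with
  | nil => simp [runWord]
  | cons u l ih =>
    rw [List.flatMap_cons, runWord_append, ih hl.of_cons, runWord_transition_map_mk]
    by_cases h : v = u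
    · subst h
      simp [(List.nodup_cons.1 hl).1]
    · simp [h]

/-- A word acts trivially if processing it preserves every locally recurrent state. -/
def ActsTrivially (w : List (Σ v, A v)) : Prop :=
  ∀ q, N.IsLocallyRecurrent q → runWord N.transition w q = q

variable {N} in
theorem ActsTrivially.flatten {ws : List (List (Σ v, A v))} (h : ∀ w ∈ ws, N.ActsTrivially w) :
    N.ActsTrivially ws.flatten := fun q hq => by
  induction ws with
  | nil => rfl
  | cons w ws ih =>
    rw [List.forall_mem_cons] at h
    rw [List.flatten_cons, runWord_append, h.1 q hq, ih h.2]

/-- Local words at all vertices can be processed simultaneously. -/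
theorem exists_runWord_transition [Fintype V] (w : ∀ v, List (A v)) :
    ∃ W, ∀ q v, runWord N.transition W q v = runWord (N.proc v).t (w v) (q v) :=
  ⟨Finset.univ.toList.flatMap fun u => (w u).map (Sigma.mk u), fun q v => by
    rw [N.runWord_transition_flatMap w (Finset.nodup_toList _), if_pos (by simp)]⟩

theorem exists_isLocallyRecurrent_runWord [Fintype V] [∀ v, Finite (Q v)] :
    ∃ W, ∀ q, N.IsLocallyRecurrent (runWord N.transition W q) := by
  choose w hw using fun v => (N.proc v).exists_runWord_mem_recurrentStates
  obtain ⟨W, hW⟩ := N.exists_runWord_transition w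
  exact ⟨W, fun q v => by rw [hW]; exact hw v _⟩

variable {N} in
theorem IsIrreducible.exists_runWord_eq [Fintype V] (hN : N.IsIrreducible) (q : ∀ v, Q v)
    {q' : ∀ v, Q v}
    (hq' : N.IsLocallyRecurrent q') : ∃ W, runWord N.transition W q = q' := by
  choose w hw using fun v => (hN v).exists_runWord_eq (q v) (hq' v)
  obtain ⟨W, hW⟩ := N.exists_runWord_transition w
  exact ⟨W, funext fun v => by rw [hW, hw]⟩

variable [∀ v, DecidableEq (A v)]

/-- The number of letters `b` sent out while a word is processed. -/
noncomputable def emission : List (Σ v, A v) → (∀ v, Q v) → (Σ v, A v) → ℕ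
  | [], _, _ => 0
  | a :: w, q, b => N.message a q b + emission w (N.transition a q) b

/-- Messages and transitions ignore the waiting letters, so executions split into a count part and a
state part. Permutation invariance of each is then read off from `exec_perm`. -/
theorem exec_eq (w : List (Σ v, A v)) (s : ((Σ v, A v) → ℤ) × (∀ v, Q v)) :
    N.exec w s = (fun b => s.1 b - w.count b + N.emission w s.2 b,
      runWord N.transition w s.2) := by
  induction w generalizing s with
  | nil => simp [exec, emission, runWord]
  | cons a w ih =>
    rw [exec, ih]
    refine Prod.ext (funext fun b => ?_) rfl
    simp only [step, emission, List.count_cons, beq_iff_eq, transition, eq_comm (a := a)]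
    push_cast
    ring

theorem emission_perm {w w' : List (Σ v, A v)} (h : w.Perm w') (q : ∀ v, Q v) (b : Σ v, A v) :
    N.emission w q b = N.emission w' q b := by
  have := congrFun (congrArg Prod.fst (N.exec_perm h (0, q))) b
  simpa [exec_eq, h.count_eq] using this

theorem runWord_transition_perm {w w' : List (Σ v, A v)} (h : w.Perm w') (q : ∀ v, Q v) :
    runWord N.transition w q = runWord N.transition w' q := by
  have := congrArg Prod.snd (N.exec_perm h (0, q))
  simpa [exec_eq] using this

theorem emission_append (w w' : List (Σ v, A v)) (q : ∀ v, Q v) (b : Σ v, A v) :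
    N.emission (w ++ w') q b = N.emission w q b + N.emission w' (runWord N.transition w q) b := by
  induction w generalizing q with
  | nil => simp [emission, runWord]
  | cons a w ih => simp [emission, runWord, ih, add_assoc]

variable {N}

variable (N) in
-- A common period of `t a` on the recurrent states shows that the defining set is nonempty, so its
-- infimum is attained and is not the default value `0`.
theorem resetNumber_spec [∀ v, Fintype (A v)] [∀ v, Finite (Q v)] (a : Σ v, A v) :
    1 ≤ N.resetNumber a ∧
      (Pi.single a (N.resetNumber a : ℤ) : (Σ v, A v) → ℤ) ∈ N.totalKernel := by
  refine Nat.sInf_mem (s := {m : ℕ | 1 ≤ m ∧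
    (Pi.single a (m : ℤ) : (Σ v, A v) → ℤ) ∈ N.totalKernel}) ?_
  obtain ⟨v, a⟩ := a
  obtain ⟨n, hn, h⟩ := (N.proc v).exists_iterate_eq a
  refine ⟨n, hn, fun u q hq => ?_⟩
  by_cases huv : u = v
  · subst huv
    rw [AbelianProcessor.act_eq_runWord (w := List.replicate n a),
      AbelianProcessor.act_eq_runWord (w := []), runWord_replicate, h q hq]
    · rfl
    · intro b
      by_cases hb : b = a <;> simp [hb]
    · intro b
      by_cases hb : b = a
      · simp [hb]
      · simp [hb, List.count_replicate, Ne.symm hb]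
  · congr 1
    funext b
    simp [huv]

/-- Together with completeness, this forces every final letter count to be exactly zero. -/
theorem IsLegal.exec_nonneg {w : List (Σ v, A v)} {s : ((Σ v, A v) → ℤ) × (∀ v, Q v)}
    (h : N.IsLegal w s) (hs : ∀ a, 0 ≤ s.1 a) (a : Σ v, A v) : 0 ≤ (N.exec w s).1 a := by
  induction w generalizing s with
  | nil => exact hs a
  | cons b w ih =>
    refine ih h.2 fun c => ?_
    have h₁ := h.1
    have h₂ := hs c
    simp only [step]
    split_ifs with hc
    · subst hc
      omega
    · omega

variable [Fintype V]

/-- The letters sent out by a word acting trivially do not depend on the locally recurrent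
state. -/
theorem ActsTrivially.emission_eq (hN : N.IsIrreducible) {w : List (Σ v, A v)}
    (hw : N.ActsTrivially w) {q q' : ∀ v, Q v} (hq : N.IsLocallyRecurrent q)
    (hq' : N.IsLocallyRecurrent q') (b : Σ v, A v) : N.emission w q b = N.emission w q' b := by
  -- Compare `w W` with `W w` from `q`: as `w` fixes `q`, the emission of `W` is the same on both
  -- sides and cancels.
  obtain ⟨W, rfl⟩ := hN.exists_runWord_eq q hq'
  have h := N.emission_perm (List.perm_append_comm (l₁ := w) (l₂ := W)) q b
  rw [emission_append, emission_append, hw q hq] at h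
  omega

variable [∀ v, Fintype (A v)]

theorem actsTrivially_of_mem_totalKernel {k : (Σ v, A v) → ℕ}
    (hk : (fun a => (k a : ℤ)) ∈ N.totalKernel) {w : List (Σ v, A v)}
    (hw : ∀ a, w.count a = k a) : N.ActsTrivially w := fun q hq => by
  have hperm : w.Perm (Finset.univ.toList.flatMap fun u =>
      (wordOf fun b : A u => k ⟨u, b⟩).map (Sigma.mk u)) := by
    rw [List.perm_iff_count]
    rintro ⟨v, a⟩
    rw [hw, List.count_flatMap, Finset.sum_map_toList, Finset.sum_eq_single v]
    · simp only [Function.comp_apply]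
      rw [List.count_map_of_injective _ _ sigma_mk_injective, count_wordOf]
    · intro u _ hu
      refine List.count_eq_zero.2 fun h => ?_
      obtain ⟨_, _, h⟩ := List.mem_map.1 h
      exact hu (congrArg Sigma.fst h)
    · simp
  funext v
  rw [N.runWord_transition_perm hperm, runWord_transition_flatMap _ _ (Finset.nodup_toList _),
    if_pos (by simp)]
  have h := hk v (q v) (hq v)
  simp only [Int.toNat_natCast, Int.toNat_neg_natCast] at h
  rw [AbelianProcessor.act_eq_runWord (w := wordOf fun b => k ⟨v, b⟩) (count_wordOf _),
    AbelianProcessor.act_eq_runWord (w := []) (by simp)] at h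
  exact h

theorem actsTrivially_replicate_resetNumber [∀ v, Finite (Q v)] (a : Σ v, A v) :
    N.ActsTrivially (List.replicate (N.resetNumber a) a) := by
  refine actsTrivially_of_mem_totalKernel (k := Pi.single a (N.resetNumber a)) ?_ ?_
  · convert (N.resetNumber_spec a).2 using 1
    funext b
    by_cases hb : b = a <;> simp [hb]
  · exact count_replicate_eq_single a _

theorem localAct_eq (k : (Σ v, A v) → ℕ) (q : ∀ v, Q v) {w : List (Σ v, A v)}
    (hw : ∀ a, w.count a = k a) :
    N.localAct k q = (fun b => (N.emission w q b : ℤ), runWord N.transition w q) := by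
  rw [localAct, N.exec_perm (w' := w) (List.perm_iff_count.2 fun a => by rw [hw, count_wordOf]),
    exec_eq]
  simp [input, hw]

/-- The arbitrary recurrent state chosen in `productionMatrix` is immaterial, because reset blocks
act trivially. -/
theorem IsIrreducible.productionMatrix_apply [∀ v, Finite (Q v)] (hN : N.IsIrreducible)
    {q : ∀ v, Q v} (hq : N.IsLocallyRecurrent q) (a b : Σ v, A v) :
    N.productionMatrix b a
      = N.emission (List.replicate (N.resetNumber a) a) q b / N.resetNumber a := by
  have h : ∃ q, N.IsLocallyRecurrent q := ⟨q, hq⟩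
  rw [productionMatrix, dif_pos h, Matrix.of_apply,
    localAct_eq (w := List.replicate (N.resetNumber a) a),
    (actsTrivially_replicate_resetNumber a).emission_eq hN hq h.choose_spec]
  · simp
  · exact count_replicate_eq_single a _

end AbelianNetwork

/-! ### The discrepancy and its uniform bound. -/

namespace AbelianNetwork

variable {V : Type*} {G : Digraph V} {A Q : V → Type*} [Fintype V] [DecidableEq V]
  [∀ v, Fintype (A v)] [∀ v, DecidableEq (A v)] {N : AbelianNetwork G A Q}

variable (N) in
/-- The difference between the numbers of letters sent out while processing a word and the numbers
predicted by the production matrix. -/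
noncomputable def discrepancy (w : List (Σ v, A v)) (q : ∀ v, Q v) (b : Σ v, A v) : ℚ :=
  N.emission w q b - (N.productionMatrix *ᵥ fun a => (w.count a : ℚ)) b

theorem discrepancy_perm {w w' : List (Σ v, A v)} (h : w.Perm w') (q : ∀ v, Q v)
    (b : Σ v, A v) : N.discrepancy w q b = N.discrepancy w' q b := by
  simp only [discrepancy, N.emission_perm h, h.count_eq]

theorem discrepancy_append (w w' : List (Σ v, A v)) (q : ∀ v, Q v) (b : Σ v, A v) :
    N.discrepancy (w ++ w') q b
      = N.discrepancy w q b + N.discrepancy w' (runWord N.transition w q) b := by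
  simp only [discrepancy, emission_append, List.count_append, mulVec, dotProduct, Nat.cast_add,
    mul_add, Finset.sum_add_distrib]
  ring

theorem ActsTrivially.discrepancy_flatten {ws : List (List (Σ v, A v))}
    (h : ∀ w ∈ ws, N.ActsTrivially w) {q : ∀ v, Q v} (hq : N.IsLocallyRecurrent q)
    (b : Σ v, A v) :
    N.discrepancy ws.flatten q b = (ws.map fun w => N.discrepancy w q b).sum := by
  induction ws with
  | nil => simp [discrepancy, emission, mulVec, dotProduct]
  | cons w ws ih =>
    rw [List.forall_mem_cons] at h
    rw [List.flatten_cons, discrepancy_append, h.1 q hq, ih h.2, List.map_cons, List.sum_cons]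

/-- The letter counts of a complete legal execution solve a linear equation up to the
discrepancy. -/
theorem IsCompleteLegal.one_sub_mulVec {w : List (Σ v, A v)} {x : (Σ v, A v) → ℕ}
    {q : ∀ v, Q v} (h : N.IsCompleteLegal w x q) :
    (1 - N.productionMatrix) *ᵥ (fun a => (w.count a : ℚ))
      = (fun a => (x a : ℚ)) + N.discrepancy w q := by
  funext b
  have h₁ := h.1.exec_nonneg (fun a => by simp [input]) b
  have h₂ := h.2 b
  simp only [exec_eq, input] at h₁ h₂
  have h₃ : (x b : ℚ) - w.count b + N.emission w q b = 0 := by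
    exact_mod_cast le_antisymm h₂ h₁
  simp only [sub_mulVec, one_mulVec, Pi.sub_apply, Pi.add_apply, discrepancy]
  linarith

variable [∀ v, Finite (Q v)]

theorem IsIrreducible.discrepancy_replicate_resetNumber (hN : N.IsIrreducible) {q : ∀ v, Q v}
    (hq : N.IsLocallyRecurrent q) (a b : Σ v, A v) :
    N.discrepancy (List.replicate (N.resetNumber a) a) q b = 0 := by
  have h : (N.resetNumber a : ℚ) ≠ 0 := by
    have := (N.resetNumber_spec a).1
    positivity
  rw [discrepancy, mulVec, dotProduct, Finset.sum_eq_single a, hN.productionMatrix_apply hq]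
  · simp [h]
  · intro c _ hc
    simp [count_replicate_eq_single, hc]
  · simp

/-- Complete rounds of resets do not change the discrepancy. -/
theorem IsIrreducible.discrepancy_eq (hN : N.IsIrreducible) {q : ∀ v, Q v}
    (hq : N.IsLocallyRecurrent q) (w : List (Σ v, A v)) (b : Σ v, A v) :
    N.discrepancy w q b
      = N.discrepancy (wordOf fun a => w.count a % N.resetNumber a) q b := by
  -- Euclidean division of each letter count by its reset number: the quotients give the blocks, the
  -- remainders the final word.
  let ws := (Finset.univ : Finset (Σ v, A v)).toList.flatMap fun a =>
    List.replicate (w.count a / N.resetNumber a) (List.replicate (N.resetNumber a) a)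
  have hws : ∀ u ∈ ws, ∃ a, u = List.replicate (N.resetNumber a) a := fun u hu => by
    obtain ⟨a, -, hu⟩ := List.mem_flatMap.1 hu
    exact ⟨a, List.eq_of_mem_replicate hu⟩
  have htriv : ∀ u ∈ ws, N.ActsTrivially u := fun u hu => by
    obtain ⟨a, rfl⟩ := hws u hu
    exact actsTrivially_replicate_resetNumber a
  have hperm : w.Perm (ws.flatten ++ wordOf fun a => w.count a % N.resetNumber a) := by
    rw [List.perm_iff_count]
    intro c
    rw [List.count_append, count_wordOf, List.count_flatten, List.map_flatMap, List.flatMap_def,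
      List.sum_flatten, List.map_map]
    simp only [Function.comp_def, List.map_replicate, List.sum_replicate, count_replicate_eq_single, smul_eq_mul]
    rw [Finset.sum_map_toList, Finset.sum_eq_single c]
    · simp [Nat.div_add_mod']
    · intro a _ ha
      simp [Ne.symm ha]
    · simp
  rw [discrepancy_perm hperm, discrepancy_append, ActsTrivially.flatten htriv q hq,
    ActsTrivially.discrepancy_flatten htriv hq, List.sum_eq_zero, zero_add]
  intro x hx
  obtain ⟨u, hu, rfl⟩ := List.mem_map.1 hx
  obtain ⟨a, rfl⟩ := hws u hu
  exact hN.discrepancy_replicate_resetNumber hq a b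

theorem IsIrreducible.exists_abs_discrepancy_le (hN : N.IsIrreducible) :
    ∃ C : ℚ, ∀ w q b, |N.discrepancy w q b| ≤ C := by
  obtain ⟨W, hW⟩ := N.exists_isLocallyRecurrent_runWord
  obtain ⟨C₁, h₁⟩ := Finite.exists_le fun i : (∀ v, Q v) × (Σ v, A v) =>
    |N.discrepancy W i.1 i.2|
  -- Remainder vectors and states are finite in number.
  obtain ⟨C₂, h₂⟩ := Finite.exists_le
    fun i : (∀ a, Fin (N.resetNumber a)) × (∀ v, Q v) × (Σ v, A v) =>
      |N.discrepancy (wordOf fun a => (i.1 a : ℕ)) i.2.1 i.2.2|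
  have hrec : ∀ w q b, N.IsLocallyRecurrent q → |N.discrepancy w q b| ≤ C₂ := fun w q b hq => by
    rw [hN.discrepancy_eq hq]
    exact h₂ (fun a => ⟨_, Nat.mod_lt (w.count a) (N.resetNumber_spec a).1⟩, q, b)
  -- Permuting `w W` into `W w` replaces `q` by a recurrent state, at the cost of two discrepancies
  -- of `W`, each at most `C₁`.
  refine ⟨C₁ + C₂ + C₁, fun w q b => ?_⟩
  have h := discrepancy_perm (N := N) (List.perm_append_comm (l₁ := w) (l₂ := W)) q b
  rw [discrepancy_append, discrepancy_append] at h
  have e₁ := abs_le.1 (h₁ (q, b))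
  have e₂ := abs_le.1 (h₁ (runWord N.transition w q, b))
  have e₃ := abs_le.1 (hrec w _ b (hW q))
  rw [abs_le]
  constructor <;> linarith [e₁.1, e₁.2, e₂.1, e₂.2, e₃.1, e₃.2]

/-- `n` repetitions of `w` have `n` times its discrepancy, which stays bounded only if it is zero.
-/
theorem IsIrreducible.discrepancy_eq_zero (hN : N.IsIrreducible) {w : List (Σ v, A v)}
    (hw : N.ActsTrivially w) {q : ∀ v, Q v} (hq : N.IsLocallyRecurrent q) (b : Σ v, A v) :
    N.discrepancy w q b = 0 := by
  obtain ⟨C, hC⟩ := hN.exists_abs_discrepancy_le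
  by_contra h
  obtain ⟨n, hn⟩ := exists_lt_nsmul (abs_pos.2 h) C
  refine absurd (hC (List.replicate n w).flatten q b) (not_le.2 ?_)
  rw [ActsTrivially.discrepancy_flatten (fun u hu => by rwa [List.eq_of_mem_replicate hu]) hq,
    List.map_replicate, List.sum_replicate, abs_nsmul]
  exact hn

theorem IsIrreducible.representsProduction (hN : N.IsIrreducible) :
    N.RepresentsProduction N.productionMatrix := fun k hk q hq => by
  have hw := actsTrivially_of_mem_totalKernel hk (count_wordOf k)
  rw [localAct_eq k q (count_wordOf k)]
  refine ⟨fun b => ?_, hw q hq⟩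
  have h := hN.discrepancy_eq_zero hw hq b
  simp only [discrepancy, count_wordOf] at h
  simpa using sub_eq_zero.1 h

theorem IsIrreducible.isUnit_one_sub_productionMatrix (hN : N.IsIrreducible)
    (hhalt : N.HaltsOnAllInputs) (q : ∀ v, Q v) : IsUnit (1 - N.productionMatrix) := by
  rw [Matrix.isUnit_iff_isUnit_det, isUnit_iff_ne_zero]
  intro hdet
  -- Pairing the count equation with a left null vector `y` eliminates the unknown counts. With `n`
  -- copies of `a` as input, `n * y a` is minus the pairing of `y` with the discrepancy, hence
  -- bounded in `n`.
  obtain ⟨y, hy, hy0⟩ := Matrix.exists_vecMul_eq_zero_iff.2 hdet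
  obtain ⟨a, ha⟩ := Function.ne_iff.1 hy
  obtain ⟨C, hC⟩ := hN.exists_abs_discrepancy_le
  obtain ⟨n, hn⟩ := exists_lt_nsmul (abs_pos.2 ha) (∑ b, |y b| * C)
  obtain ⟨w, hw⟩ := hhalt (Pi.single a n) q
  have h := congrArg (y ⬝ᵥ ·) hw.one_sub_mulVec
  simp only [dotProduct_mulVec, hy0, zero_dotProduct, dotProduct_add] at h
  have hx : (fun b => ((Pi.single a n : (Σ v, A v) → ℕ) b : ℚ)) = Pi.single a (n : ℚ) := by
    funext b
    by_cases hb : b = a <;> simp [hb]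
  rw [hx, dotProduct_single] at h
  refine absurd hn (not_lt.2 ?_)
  calc n • |y a| = |y ⬝ᵥ N.discrepancy w q| := by
        rw [← neg_eq_of_add_eq_zero_right h.symm, abs_neg, abs_mul, Nat.abs_cast, nsmul_eq_mul,
          mul_comm]
    _ ≤ ∑ b, |y b * N.discrepancy w q b| := Finset.abs_sum_le_sum_abs _ _
    _ ≤ ∑ b, |y b| * C := Finset.sum_le_sum fun b _ => by
        rw [abs_mul]
        exact mul_le_mul_of_nonneg_left (hC w q b) (abs_nonneg _)

/-- The letter counts of complete legal executions are linear in the input up to a bounded error. -/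
theorem IsIrreducible.exists_abs_count_sub_le (hN : N.IsIrreducible)
    (hunit : IsUnit (1 - N.productionMatrix)) :
    ∃ C : ℚ, 0 ≤ C ∧ ∀ (x : (Σ v, A v) → ℕ) (q : ∀ v, Q v) (w : List (Σ v, A v)),
      N.IsCompleteLegal w x q → ∀ a,
        |(w.count a : ℚ) - ((1 - N.productionMatrix)⁻¹ *ᵥ fun a => (x a : ℚ)) a| ≤ C := by
  obtain ⟨C, hC⟩ := hN.exists_abs_discrepancy_le
  obtain ⟨D, hD⟩ := Finite.exists_le fun a => ∑ b, |(1 - N.productionMatrix)⁻¹ a b| * C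
  -- With an empty alphabet `D` may be negative; the sup norm estimate needs a nonnegative constant.
  refine ⟨max D 0, le_max_right _ _, fun x q w hw a => le_max_of_le_left ?_⟩
  have h := congrArg ((1 - N.productionMatrix)⁻¹ *ᵥ ·) hw.one_sub_mulVec
  simp only [mulVec_mulVec, mulVec_add] at h
  rw [Matrix.nonsing_inv_mul _ ((Matrix.isUnit_iff_isUnit_det _).1 hunit), one_mulVec] at h
  have ha := congrFun h a
  rw [Pi.add_apply] at ha
  rw [ha, add_sub_cancel_left]
  refine le_trans ?_ (hD a)
  refine (Finset.abs_sum_le_sum_abs _ _).trans (Finset.sum_le_sum fun b _ => ?_)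
  rw [abs_mul]
  exact mul_le_mul_of_nonneg_left (hC w q b) (abs_nonneg _)

end AbelianNetwork

theorem theorem4p2 {V : Type*} [Fintype V] [DecidableEq V] {G : Digraph V} {A Q : V → Type*}
    [∀ v, Fintype (A v)] [∀ v, DecidableEq (A v)] [∀ v, Finite (Q v)]
    (N : AbelianNetwork G A Q) (hirr : N.IsIrreducible) (hhalt : N.HaltsOnAllInputs) :
    N.RepresentsProduction N.productionMatrix ∧
    IsUnit (1 - N.productionMatrix) ∧
    (∃ C : ℝ, ∀ (x : (Σ v, A v) → ℕ) (q : ∀ v, Q v),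
      ‖(fun a => (N.odometer x q a : ℚ)) -
        (1 - N.productionMatrix)⁻¹ *ᵥ (fun a => (x a : ℚ))‖ ≤ C) ∧
    (∃ C' : ℚ, ∀ (x : (Σ v, A v) → ℕ) (q : ∀ v, Q v) (w : List (Σ v, A v)),
      N.IsCompleteLegal w x q →
      |(w.length : ℚ) -
        ∑ a, ((1 - N.productionMatrix)⁻¹ *ᵥ (fun a => (x a : ℚ))) a| ≤ C') := by
  have hunit : IsUnit (1 - N.productionMatrix) := by
    rcases isEmpty_or_nonempty (∀ v, Q v) with h | ⟨⟨q⟩⟩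
    -- Without any state the production matrix takes its default value `0`.
    · rw [AbelianNetwork.productionMatrix, dif_neg fun ⟨q, _⟩ => h.false q, sub_zero]
      exact isUnit_one
    · exact hirr.isUnit_one_sub_productionMatrix hhalt q
  obtain ⟨C, hC0, hC⟩ := hirr.exists_abs_count_sub_le hunit
  refine ⟨hirr.representsProduction, hunit, ⟨C, fun x q => ?_⟩,
    ⟨∑ _a : Σ v, A v, C, fun x q w hw => ?_⟩⟩
  · obtain ⟨w, hw⟩ := hhalt x q
    rw [pi_norm_le_iff_of_nonneg (by exact_mod_cast hC0)]
    intro a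
    rw [Pi.sub_apply, N.odometer_eq hw, ← Rat.norm_cast_real, Real.norm_eq_abs]
    exact_mod_cast hC x q w hw a
  · have hlen : (w.length : ℚ) = ∑ a, (w.count a : ℚ) := by
      rw [← Nat.cast_sum, ← Multiset.coe_card, ← Multiset.sum_count_eq_card (s := Finset.univ)]
      · simp
      · simp
    rw [hlen, ← Finset.sum_sub_distrib]
    exact (Finset.abs_sum_le_sum_abs _ _).trans (Finset.sum_le_sum fun a _ => hC x q w hw a)
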